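/- Let $\mathcal H$ be a separable complex Hilbert space and let $L_2(\mathbb R;\mathcal H)$ be the Hilbert space of (classes of) square-integrable $\mathcal H$-valued functions on $\mathbb R$ with respect to Lebesgue measure. For a measurable, essentially bounded function $A$ from $\mathbb R$ to the bounded operators on $\mathcal H$ (measurable meaning that $t\mapsto A(t)x$ is measurable for each $x\in\mathcal H$), let $M(A(t))$ be the multiplication operator $(M(A(t))f)(t)=A(t)f(t)$ on $L_2(\mathbb R;\mathcal H)$; in particular, for $\varphi\in L_\infty(\mathbb R)$ (complex-valued), let $M(\varphi)$ be the scalar multiplication $(M(\varphi)f)(t)=\varphi(t)f(t)$. For $\sigma\in\mathbb R$ let $T_\sigma$ be the time translation $(T_\sigma f)(t)=f(t-\sigma)$. A unitary group $(e^{-i\sigma K})_{\sigma\in\mathbb R}$ on $L_2(\mathbb R;\mathcal H)$ is called a unitary evolution group if, for every $\sigma\in\mathbb R$, the operator $e^{-i\sigma K}T_\sigma^*$ commutes with $M(\varphi)$ for every $\varphi\in L_\infty(\mathbb R)$. **Theorem.** A strongly continuous one-parameter unitary group $(e^{-i\sigma K})_{\sigma\in\mathbb R}$ on $L_2(\mathbb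 R;\mathcal H)$ is a unitary evolution group if and only if there is a measurable function $t\mapsto U(t)$ from $\mathbb R$ to the unitary operators on $\mathcal H$ such that $$e^{-i\sigma K}=\mathcal U\,T_\sigma\,\mathcal U^*\qquad\text{for all }\sigma\in\mathbb R,$$ where $\mathcal U=M(U(t))$. -/

import Mathlib

open MeasureTheory
open scoped ENNReal

noncomputable section

namespace Howland

variable {H : Type*} [NormedAddCommGroup H] [InnerProductSpace ℂ H]

/-- The space `L₂(ℝ; H)` of (classes of) square-integrable `H`-valued functions, with respect to
Lebesgue measure. -/
abbrev L2R (H : Type*) [NormedAddCommGroup H] [InnerProductSpace ℂ H] : Type _ :=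
  Lp H 2 (volume : Measure ℝ)

/-- An operator-valued function `A(t)` is measurable if `t ↦ A(t) x` is (strongly) measurable for
every vector `x`. -/
def MeasurableOpFun (A : ℝ → H →L[ℂ] H) : Prop :=
  ∀ x : H, StronglyMeasurable fun t => A t x

/-- An operator-valued function is essentially bounded: `ess sup ‖A(t)‖ < ∞`. -/
def EssBoundedOpFun (A : ℝ → H →L[ℂ] H) : Prop :=
  ∃ C : ℝ, ∀ᵐ t : ℝ, ‖A t‖ ≤ C

theorem MeasurableOpFun.stronglyMeasurable_apply {A : ℝ → H →L[ℂ] H} (hA : MeasurableOpFun A)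
    {f : ℝ → H} (hf : StronglyMeasurable f) : StronglyMeasurable fun t => A t (f t) := by
  have key : ∀ g : SimpleFunc ℝ H, StronglyMeasurable fun t => A t (g t) := by
    intro g
    induction g using SimpleFunc.induction with
    | const c hs =>
      rename_i s
      have h : (fun t => A t ((SimpleFunc.piecewise s hs (SimpleFunc.const ℝ c)
          (SimpleFunc.const ℝ 0)) t)) = s.indicator fun t => A t c := by
        funext t
        by_cases ht : t ∈ s <;> simp [ht]
      rw [h]
      exact (hA c).indicator hs
    | add _ h1 h2 =>
      have h := h1.add h2
      simp only [SimpleFunc.coe_add, Pi.add_apply, _root_.map_add]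
      exact h
  refine stronglyMeasurable_of_tendsto Filter.atTop (fun n => key (hf.approx n)) ?_
  rw [tendsto_pi_nhds]
  intro t
  exact ((A t).continuous.tendsto _).comp (hf.tendsto_approx t)

theorem memLp_opFun_apply {A : ℝ → H →L[ℂ] H} (hA : MeasurableOpFun A)
    (hb : EssBoundedOpFun A) (f : L2R H) :
    MemLp (fun t => A t (f t)) 2 (volume : Measure ℝ) := by
  obtain ⟨C, hC⟩ := hb
  refine MemLp.of_le_mul (c := C) (Lp.memLp f)
    (hA.stronglyMeasurable_apply (Lp.stronglyMeasurable f)).aestronglyMeasurable ?_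
  filter_upwards [hC] with t ht
  exact ((A t).le_opNorm _).trans (by gcongr)

/-- The multiplication operator `M(A(t))` on `L₂(ℝ; H)`, `(M(A(t)) f)(t) = A(t) f(t)`, for a
measurable, essentially bounded operator-valued function `A(t)`. -/
def mulOp (A : ℝ → H →L[ℂ] H) (hA : MeasurableOpFun A) (hb : EssBoundedOpFun A) :
    L2R H →L[ℂ] L2R H :=
  LinearMap.mkContinuousOfExistsBound
    { toFun := fun f => (memLp_opFun_apply hA hb f).toLp _
      map_add' := by
        intro f g
        rw [← MemLp.toLp_add, MemLp.toLp_eq_toLp_iff]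
        filter_upwards [Lp.coeFn_add f g] with t ht
        rw [ht]
        exact _root_.map_add (A t) (f t) (g t)
      map_smul' := by
        intro c f
        rw [RingHom.id_apply, ← MemLp.toLp_const_smul, MemLp.toLp_eq_toLp_iff]
        filter_upwards [Lp.coeFn_smul c f] with t ht
        rw [ht]
        exact _root_.map_smul (A t) c (f t) }
    (by
      obtain ⟨C, hC⟩ := id hb
      refine ⟨C, fun f => ?_⟩
      refine Lp.norm_le_mul_norm_of_ae_le_mul ?_
      filter_upwards [hC, (memLp_opFun_apply hA hb f).coeFn_toLp] with t ht h
      simp only [LinearMap.coe_mk, AddHom.coe_mk]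
      rw [h]
      exact ((A t).le_opNorm _).trans (by gcongr))

theorem measurableOpFun_scalar (φ : Lp ℂ ∞ (volume : Measure ℝ)) :
    MeasurableOpFun fun t => φ t • (1 : H →L[ℂ] H) := by
  intro x
  simpa using (Lp.stronglyMeasurable φ).smul_const x

theorem essBoundedOpFun_scalar (φ : Lp ℂ ∞ (volume : Measure ℝ)) :
    EssBoundedOpFun fun t => φ t • (1 : H →L[ℂ] H) := by
  refine ⟨‖φ‖, ?_⟩
  have h := ae_le_eLpNormEssSup (f := φ) (μ := (volume : Measure ℝ))
  filter_upwards [h] with t ht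
  have h1 : ‖φ t‖ ≤ ‖φ‖ := by
    rw [Lp.norm_def, ← toReal_enorm]
    refine ENNReal.toReal_mono (Lp.eLpNorm_ne_top φ) ?_
    rwa [eLpNorm_exponent_top]
  refine ContinuousLinearMap.opNorm_le_bound _ (norm_nonneg _) fun x => ?_
  rw [_root_.smul_apply, norm_smul, one_apply_eq_self]
  gcongr

/-- The scalar multiplication `M(φ)` on `L₂(ℝ; H)`, `(M(φ) f)(t) = φ(t) f(t)`, for
`φ ∈ L_∞(ℝ)`. -/
def scalarMul (φ : Lp ℂ ∞ (volume : Measure ℝ)) : L2R H →L[ℂ] L2R H :=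
  mulOp (fun t => φ t • (1 : H →L[ℂ] H)) (measurableOpFun_scalar φ) (essBoundedOpFun_scalar φ)

/-- Time translation on `L₂(ℝ; H)`, `(T_σ f)(t) = f(t - σ)`. -/
def timeShift (σ : ℝ) : L2R H →L[ℂ] L2R H :=
  (Lp.compMeasurePreservingₗᵢ ℂ (fun t : ℝ => t - σ)
    (measurePreserving_sub_right volume σ)).toContinuousLinearMap

theorem essBoundedOpFun_unitary [CompleteSpace H] (U : ℝ → unitary (H →L[ℂ] H)) :
    EssBoundedOpFun fun t => (U t : H →L[ℂ] H) :=
  ⟨1, Filter.Eventually.of_forall fun t =>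
    ContinuousLinearMap.opNorm_le_bound _ zero_le_one fun x => by
      rw [one_mul]
      exact (ContinuousLinearMap.norm_map_of_mem_unitary (U t).2 x).le⟩

/-- A one-parameter group of unitary operators on a Hilbert space. -/
structure IsUnitaryGroup {E : Type*} [NormedAddCommGroup E] [InnerProductSpace ℂ E]
    [CompleteSpace E] (V : ℝ → E →L[ℂ] E) : Prop where
  mem_unitary : ∀ σ, V σ ∈ unitary (E →L[ℂ] E)
  map_zero : V 0 = 1
  map_add : ∀ σ τ, V (σ + τ) = V σ * V τ

/-- A unitary evolution group on `L₂(ℝ; H)`: a unitary group `V` such that `V(σ) T_σ^*` commutes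
with every scalar multiplication `M(φ)`, `φ ∈ L_∞(ℝ)`, for every `σ`. -/
structure IsUnitaryEvolutionGroup [CompleteSpace H] (V : ℝ → L2R H →L[ℂ] L2R H) : Prop where
  isUnitaryGroup : IsUnitaryGroup V
  commute : ∀ (σ : ℝ) (φ : Lp ℂ ∞ (volume : Measure ℝ)),
    Commute (V σ * (timeShift σ).adjoint) (scalarMul φ)

end Howland

end

noncomputable section

namespace Howland

variable {H : Type*} [NormedAddCommGroup H] [InnerProductSpace ℂ H]

/-! Write W(σ) = V(σ) T_σ^*. The commutation hypothesis makes W(σ) a unitary multiplication operator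
with fibres W(σ,t), and the group law of V becomes the cocycle identity W(σ+τ,t) = W(σ,t) W(τ,t-σ).
Put U(t) = W(t-s,t) for a fixed s. Taking τ = t-σ-s gives W(σ,t) U(t-σ) = U(t), which is V(σ) M(U) =
M(U) T_σ read fibrewise.

Fibres exist only for almost every t, with a null set depending on σ, so U(t) needs a jointly
measurable version of the fibres (`exists_stronglyMeasurable_uncurry`, from strong continuity) and a
generic s, found by Fubini (`ae_ae_sub_of_ae`, `ae_ae_ae_rotate`). The intertwining relation then
holds for almost every σ, and the group law extends it to all σ (`eq_of_ae_eq_of_map_add`).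

Fibre operators are never built for W(σ). Only the vectors W(σ,t) b_i and W(σ,t)^* b_i on a Hilbert
basis are used (`symbol`), and every operator identity is a countable family of scalar ones.
`IsAdjointPair.exists_unitary` turns such vectors back into a unitary.

Conversely, conjugation by T_σ only translates φ, so U T_σ U^* T_σ^* is a product of two operators
commuting with every M(φ). -/

/-! ### Multiplication operators and translations -/

theorem mulOp_coeFn {A : ℝ → H →L[ℂ] H} (hA : MeasurableOpFun A) (hb : EssBoundedOpFun A)
    (f : L2R H) : mulOp A hA hb f =ᵐ[volume] fun t => A t (f t) :=
  (memLp_opFun_apply hA hb f).coeFn_toLp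

theorem scalarMul_coeFn (φ : Lp ℂ ∞ (volume : Measure ℝ)) (f : L2R H) :
    scalarMul φ f =ᵐ[volume] fun t => φ t • f t :=
  mulOp_coeFn _ _ f

theorem timeShift_coeFn (σ : ℝ) (f : L2R H) :
    timeShift σ f =ᵐ[volume] fun t => f (t - σ) :=
  Lp.coeFn_compMeasurePreserving f (measurePreserving_sub_right volume σ)

theorem ae_comp_sub_right {p : ℝ → Prop} (h : ∀ᵐ t, p t) (σ : ℝ) : ∀ᵐ t, p (t - σ) :=
  (measurePreserving_sub_right volume σ).quasiMeasurePreserving.ae h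

theorem ae_comp_sub_left {p : ℝ → Prop} (h : ∀ᵐ t, p t) (a : ℝ) : ∀ᵐ t, p (a - t) :=
  (Measure.measurePreserving_sub_left volume a).quasiMeasurePreserving.ae h

theorem timeShift_add (σ τ : ℝ) :
    (timeShift (σ + τ) : L2R H →L[ℂ] L2R H) = timeShift σ * timeShift τ := by
  ext1 f
  refine Lp.ext ?_
  filter_upwards [timeShift_coeFn (σ + τ) f, timeShift_coeFn σ (timeShift τ f),
    ae_comp_sub_right (timeShift_coeFn τ f) σ] with t h1 h2 h3
  rw [mul_apply_eq_comp, h1, h2, h3, sub_sub]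

theorem timeShift_zero : (timeShift 0 : L2R H →L[ℂ] L2R H) = 1 := by
  ext1 f
  refine Lp.ext ?_
  filter_upwards [timeShift_coeFn 0 f] with t h1
  rw [h1, sub_zero]
  rfl

theorem timeShift_mul_neg (σ : ℝ) :
    (timeShift σ : L2R H →L[ℂ] L2R H) * timeShift (-σ) = 1 := by
  rw [← timeShift_add, add_neg_cancel, timeShift_zero]

theorem norm_timeShift_apply (σ : ℝ) (f : L2R H) : ‖timeShift σ f‖ = ‖f‖ :=
  LinearIsometry.norm_map _ f

theorem continuous_timeShift {f : ℝ → L2R H} (hf : Continuous f) :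
    Continuous fun σ => timeShift σ (f σ) := by
  have hg : Continuous fun σ : ℝ => (⟨fun t => t - σ, by fun_prop⟩ : C(ℝ, ℝ)) := by
    refine ContinuousMap.continuous_of_continuous_uncurry _ ?_
    simp only [Function.uncurry_def, ContinuousMap.coe_mk]
    fun_prop
  exact hf.compMeasurePreservingLp hg (fun σ => measurePreserving_sub_right volume σ) (by simp)

theorem commute_mulOp_scalarMul {A : ℝ → H →L[ℂ] H} (hA : MeasurableOpFun A)
    (hb : EssBoundedOpFun A) (φ : Lp ℂ ∞ (volume : Measure ℝ)) :
    Commute (mulOp A hA hb) (scalarMul φ) := by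
  refine ContinuousLinearMap.ext fun f => Lp.ext ?_
  filter_upwards [mulOp_coeFn hA hb (scalarMul φ f), mulOp_coeFn hA hb f,
    scalarMul_coeFn φ f, scalarMul_coeFn φ (mulOp A hA hb f)] with t h1 h2 h3 h4
  rw [mul_apply_eq_comp, mul_apply_eq_comp, h1, h4, h2, h3, map_smul]

/-- The translate `φ(· - σ)` of `φ ∈ L_∞(ℝ)`. -/
def translate (σ : ℝ) (φ : Lp ℂ ∞ (volume : Measure ℝ)) : Lp ℂ ∞ (volume : Measure ℝ) :=
  Lp.compMeasurePreserving (fun t : ℝ => t - σ) (measurePreserving_sub_right volume σ) φ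

theorem translate_coeFn (σ : ℝ) (φ : Lp ℂ ∞ (volume : Measure ℝ)) :
    translate σ φ =ᵐ[volume] fun t => φ (t - σ) :=
  Lp.coeFn_compMeasurePreserving φ (measurePreserving_sub_right volume σ)

theorem timeShift_mul_scalarMul (σ : ℝ) (φ : Lp ℂ ∞ (volume : Measure ℝ)) :
    (timeShift σ : L2R H →L[ℂ] L2R H) * scalarMul φ
      = scalarMul (translate σ φ) * timeShift σ := by
  refine ContinuousLinearMap.ext fun f => Lp.ext ?_
  filter_upwards [timeShift_coeFn σ (scalarMul φ f), ae_comp_sub_right (scalarMul_coeFn φ f) σ,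
    scalarMul_coeFn (translate σ φ) (timeShift σ f), timeShift_coeFn σ f,
    translate_coeFn σ φ] with t h1 h2 h3 h4 h5
  rw [mul_apply_eq_comp, mul_apply_eq_comp, h1, h2, h3, h4, h5]

theorem translate_translate_neg (σ : ℝ) (φ : Lp ℂ ∞ (volume : Measure ℝ)) :
    translate σ (translate (-σ) φ) = φ := by
  refine Lp.ext ?_
  filter_upwards [translate_coeFn σ (translate (-σ) φ),
    ae_comp_sub_right (translate_coeFn (-σ) φ) σ] with t h1 h2
  rw [h1, h2, sub_neg_eq_add, sub_add_cancel]

/-- The indicator function of a measurable set, as an element of `L_∞(ℝ)`. -/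
def indicatorTop {s : Set ℝ} (hs : MeasurableSet s) : Lp ℂ ∞ (volume : Measure ℝ) :=
  MemLp.toLp (s.indicator fun _ => (1 : ℂ)) ((memLp_top_const (1 : ℂ)).indicator hs)

theorem scalarMul_indicatorTop_coeFn {s : Set ℝ} (hs : MeasurableSet s) (f : L2R H) :
    scalarMul (indicatorTop hs) f =ᵐ[volume] s.indicator f := by
  filter_upwards [scalarMul_coeFn (indicatorTop hs) f, MemLp.coeFn_toLp (μ := volume)
    ((memLp_top_const (1 : ℂ)).indicator hs : MemLp (s.indicator fun _ => (1 : ℂ)) ∞ _)]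
    with t h1 h2
  rw [h1, indicatorTop, h2]
  by_cases h : t ∈ s <;> simp [h]

theorem inner_scalarMul_indicatorTop {s : Set ℝ} (hs : MeasurableSet s) (f g : L2R H) :
    inner ℂ f (scalarMul (indicatorTop hs) g) = ∫ t in s, inner ℂ (f t) (g t) := by
  rw [L2.inner_def, ← integral_indicator hs]
  refine integral_congr_ae ?_
  filter_upwards [scalarMul_indicatorTop_coeFn hs g] with t h
  rw [h]
  by_cases h : t ∈ s <;> simp [h]

/-! ### Separability and measurability through a Hilbert basis -/

theorem countable_index_of_hilbertBasis [TopologicalSpace.SeparableSpace H] {ι : Type*}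
    (b : HilbertBasis ι ℂ H) : Countable ι := by
  refine Pairwise.countable_of_isOpen_disjoint (s := fun i => Metric.ball (b i) (1 / 2))
    (fun i j hij => ?_) (fun i => Metric.isOpen_ball) fun i => Metric.nonempty_ball.2 (by norm_num)
  refine Metric.ball_disjoint_ball ?_
  -- Basis vectors are √2 apart, more than the sum of the two radii 1/2.
  have h : ‖b i - b j‖ * ‖b i - b j‖ = 2 := by
    rw [norm_sub_mul_self (𝕜 := ℂ), b.orthonormal.1 i, b.orthonormal.1 j, b.orthonormal.2 hij]
    norm_num
  rw [dist_eq_norm]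
  nlinarith [norm_nonneg (b i - b j)]

theorem stronglyMeasurable_of_inner_basis {ι : Type*} [Countable ι] (b : HilbertBasis ι ℂ H)
    {X : Type*} [MeasurableSpace X] {f : X → H}
    (hf : ∀ i, StronglyMeasurable fun x => inner ℂ (b i) (f x)) : StronglyMeasurable f := by
  refine stronglyMeasurable_of_tendsto Filter.atTop
    (f := fun (s : Finset ι) x => ∑ i ∈ s, inner ℂ (b i) (f x) • b i) (fun s => ?_) ?_
  · exact Finset.stronglyMeasurable_fun_sum s fun i _ => (hf i).smul_const (b i)
  · rw [tendsto_pi_nhds]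
    intro x
    have h := b.hasSum_repr (f x)
    simp only [b.repr_apply_apply] at h
    exact h

theorem measurableOpFun_of_basis {ι : Type*} [Countable ι] (b : HilbertBasis ι ℂ H)
    {A : ℝ → H →L[ℂ] H} (hA : ∀ i, StronglyMeasurable fun t => A t (b i)) :
    MeasurableOpFun A := by
  intro x
  refine stronglyMeasurable_of_tendsto Filter.atTop
    (f := fun (s : Finset ι) t => ∑ i ∈ s, b.repr x i • A t (b i)) (fun s => ?_) ?_
  · exact Finset.stronglyMeasurable_fun_sum s fun i _ => (hA i).const_smul _
  · rw [tendsto_pi_nhds]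
    intro t
    have h := (A t).hasSum (b.hasSum_repr x)
    simp only [map_smul] at h
    exact h

/-! ### Adjoints and unitarity -/

section Complete

variable [CompleteSpace H]

theorem adjoint_timeShift (σ : ℝ) :
    (timeShift σ : L2R H →L[ℂ] L2R H).adjoint = timeShift (-σ) := by
  have h : (timeShift σ : L2R H →L[ℂ] L2R H).adjoint * timeShift σ = 1 :=
    (ContinuousLinearMap.norm_map_iff_adjoint_comp_self _).1 (norm_timeShift_apply σ)
  exact left_inv_eq_right_inv h (timeShift_mul_neg σ)

/-- Operators commuting with all scalar multiplications satisfy the adjoint relation pointwise. -/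
theorem ae_inner_adjoint_apply {W : L2R H →L[ℂ] L2R H}
    (hW : ∀ φ, Commute W (scalarMul φ)) (f g : L2R H) :
    ∀ᵐ t, inner ℂ (W.adjoint f t) (g t) = inner ℂ (f t) (W g t) := by
  -- Testing against indicators localises the global adjoint relation to almost every t.
  refine Integrable.ae_eq_of_forall_setIntegral_eq _ _ (L2.integrable_inner _ _)
    (L2.integrable_inner _ _) fun s hs _ => ?_
  rw [← inner_scalarMul_indicatorTop hs, ← inner_scalarMul_indicatorTop hs,
    ContinuousLinearMap.adjoint_inner_left, ← mul_apply_eq_comp,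
    ← mul_apply_eq_comp, (hW _).eq]

theorem commute_adjoint_of_mem_unitary {E : Type*} [NormedAddCommGroup E] [InnerProductSpace ℂ E]
    [CompleteSpace E] {W S : E →L[ℂ] E} (hW : W ∈ unitary (E →L[ℂ] E)) (h : Commute W S) :
    Commute W.adjoint S := by
  have h1 : W.adjoint * W = 1 := Unitary.star_mul_self_of_mem hW
  have h2 : W * W.adjoint = 1 := Unitary.mul_star_self_of_mem hW
  calc W.adjoint * S = W.adjoint * (S * W) * W.adjoint := by
        rw [mul_assoc, mul_assoc, h2, mul_one]
    _ = (W.adjoint * W) * S * W.adjoint := by rw [← h.eq]; simp only [mul_assoc]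
    _ = S * W.adjoint := by rw [h1, one_mul]

theorem MeasurableOpFun.adjoint [TopologicalSpace.SeparableSpace H] {A : ℝ → H →L[ℂ] H}
    (hA : MeasurableOpFun A) : MeasurableOpFun fun t => (A t).adjoint := by
  intro x
  obtain ⟨w, b, -⟩ := exists_hilbertBasis ℂ H
  have := countable_index_of_hilbertBasis b
  refine stronglyMeasurable_of_inner_basis b fun i => ?_
  simp only [ContinuousLinearMap.adjoint_inner_right]
  exact (hA (b i)).inner stronglyMeasurable_const

theorem mulOp_unitary_mem_unitary [TopologicalSpace.SeparableSpace H]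
    (U : ℝ → unitary (H →L[ℂ] H)) (hU : MeasurableOpFun fun t => (U t : H →L[ℂ] H)) :
    mulOp (fun t => (U t : H →L[ℂ] H)) hU (essBoundedOpFun_unitary U)
      ∈ unitary (L2R H →L[ℂ] L2R H) := by
  set M := mulOp (fun t => (U t : H →L[ℂ] H)) hU (essBoundedOpFun_unitary U)
  have h1 : M.adjoint * M = 1 := by
    refine (ContinuousLinearMap.norm_map_iff_adjoint_comp_self _).1 fun f => ?_
    rw [Lp.norm_def, Lp.norm_def]
    congr 1
    refine eLpNorm_congr_norm_ae ?_
    filter_upwards [mulOp_coeFn hU (essBoundedOpFun_unitary U) f] with t ht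
    rw [ht]
    exact ContinuousLinearMap.norm_map_of_mem_unitary (U t).2 _
  -- An isometry need not be onto; M(U(t)^*) is an explicit right inverse.
  have h2 : M * mulOp (fun t => ((U⁻¹ t : unitary (H →L[ℂ] H)) : H →L[ℂ] H)) hU.adjoint
      (essBoundedOpFun_unitary U⁻¹) = 1 := by
    refine ContinuousLinearMap.ext fun f => Lp.ext ?_
    have h3 := mulOp_coeFn hU.adjoint (essBoundedOpFun_unitary U⁻¹) f
    filter_upwards [h3, mulOp_coeFn hU (essBoundedOpFun_unitary U) (mulOp _ hU.adjoint
      (essBoundedOpFun_unitary U⁻¹) f)] with t h4 h5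
    refine h5.trans ((congrArg _ h4).trans ?_)
    exact congr($(Unitary.mul_star_self_of_mem (U t).2) (f t))
  refine ⟨h1, ?_⟩
  have h3 := left_inv_eq_right_inv h1 h2
  rw [← h3] at h2
  exact h2

/-! ### Joint measurability of continuous curves -/

open Filter Topology in
/-- A continuous curve in `L₂(ℝ; H)` has a jointly measurable representative. -/
theorem exists_stronglyMeasurable_uncurry [TopologicalSpace.SeparableSpace H] {G : ℝ → L2R H}
    (hG : Continuous G) : ∃ F : ℝ × ℝ → H, StronglyMeasurable F ∧
      ∀ σ, (fun t => F (σ, t)) =ᵐ[volume] G σ := by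
  have hex : ∀ (k : ℕ) (σ : ℝ),
      ∃ n, ‖G (TopologicalSpace.denseSeq ℝ n) - G σ‖ < (1 / 4 : ℝ) ^ k := by
    intro k σ
    have ho : IsOpen {τ | ‖G τ - G σ‖ < (1 / 4 : ℝ) ^ k} :=
      isOpen_lt (by fun_prop) continuous_const
    obtain ⟨_, h1, n, rfl⟩ := (TopologicalSpace.denseRange_denseSeq ℝ).inter_open_nonempty _ ho
      ⟨σ, by simp⟩
    exact ⟨n, h1⟩
  classical
  -- Choosing the least admissible index makes the approximation measurable in σ.
  let N : ℕ → ℝ → ℕ := fun k σ => Nat.find (hex k σ)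
  have hN : ∀ k, Measurable (N k) := fun k =>
    measurable_find (hex k) fun n => (isOpen_lt (by fun_prop) continuous_const).measurableSet
  let f : ℕ → ℝ × ℝ → H := fun k p => G (TopologicalSpace.denseSeq ℝ (N k p.1)) p.2
  have hf : ∀ k, StronglyMeasurable (f k) := by
    intro k
    borelize H
    have : SecondCountableTopology H := UniformSpace.secondCountable_of_separable H
    rw [stronglyMeasurable_iff_measurable]
    have h1 : Measurable fun p : ℕ × ℝ => G (TopologicalSpace.denseSeq ℝ p.1) p.2 :=
      measurable_from_prod_countable_right fun n =>
        (Lp.stronglyMeasurable (G (TopologicalSpace.denseSeq ℝ n))).measurable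
    exact h1.comp (((hN k).comp measurable_fst).prodMk measurable_snd)
  refine ⟨fun p => limUnder atTop fun k => f k p, StronglyMeasurable.limUnder hf, fun σ => ?_⟩
  let g : ℕ → L2R H := fun k => G (TopologicalSpace.denseSeq ℝ (N k σ))
  have hg : ∀ k, ‖g k - G σ‖ < (1 / 4 : ℝ) ^ k := fun k => Nat.find_spec (hex k σ)
  have hlim : Tendsto g atTop (𝓝 (G σ)) := by
    rw [tendsto_iff_norm_sub_tendsto_zero]
    exact squeeze_zero (fun _ => norm_nonneg _) (fun k => (hg k).le)
      (tendsto_pow_atTop_nhds_zero_of_lt_one (by norm_num) (by norm_num))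
  have hsum : Summable fun k : ℕ => 2 * (1 / 4 : ℝ) ^ k :=
    (summable_geometric_of_lt_one (by norm_num) (by norm_num)).mul_left 2
  have hcau : ∀ᵐ t, ∃ l, Tendsto (fun k => g k t) atTop (𝓝 l) := by
    -- Summable Cauchy bounds give convergence a.e. along the whole sequence, so one `limUnder`
    -- serves all σ. The factor 2 comes from comparing two terms through G σ.
    refine Lp.ae_tendsto_of_cauchy_eLpNorm (p := 2)
      (fun n => (Lp.stronglyMeasurable (g n)).aestronglyMeasurable) (by norm_num)
      (B := fun k => ENNReal.ofReal (2 * (1 / 4 : ℝ) ^ k)) hsum.tsum_ofReal_ne_top ?_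
    intro K n m hn hm
    rw [← eLpNorm_congr_ae (Lp.coeFn_sub (g n) (g m)), ← Lp.enorm_def, ← ofReal_norm]
    refine (ENNReal.ofReal_lt_ofReal_iff (by positivity)).2 ?_
    have h1 : (1 / 4 : ℝ) ^ n ≤ (1 / 4) ^ K := pow_le_pow_of_le_one (by norm_num) (by norm_num) hn
    have h2 : (1 / 4 : ℝ) ^ m ≤ (1 / 4) ^ K := pow_le_pow_of_le_one (by norm_num) (by norm_num) hm
    have h3 := norm_sub_le_norm_sub_add_norm_sub (g n) (G σ) (g m)
    rw [norm_sub_rev (G σ)] at h3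
    linarith [hg n, hg m]
  -- A subsequence suffices to identify the limit already known to exist.
  obtain ⟨ns, hns, hae⟩ := (tendstoInMeasure_of_tendsto_Lp hlim).exists_seq_tendsto_ae
  filter_upwards [hcau, hae] with t ⟨l, hl⟩ h2
  rw [← tendsto_nhds_unique (hl.comp hns.tendsto_atTop) h2]
  exact hl.limUnder_eq

end Complete

/-! ### Fibres of decomposable operators; unitaries from basis images -/

/-- An everywhere positive weight in `L₂(ℝ)`. -/
def weight (t : ℝ) : ℂ := ((1 + t ^ 2)⁻¹ : ℝ)

theorem weight_ne_zero (t : ℝ) : weight t ≠ 0 := by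
  have : (1 + t ^ 2)⁻¹ ≠ 0 := by positivity
  exact Complex.ofReal_ne_zero.2 this

theorem conj_weight (t : ℝ) : (starRingEnd ℂ) (weight t) = weight t :=
  Complex.conj_ofReal _

theorem continuous_weight : Continuous weight :=
  Complex.continuous_ofReal.comp
    (Continuous.inv₀ (by fun_prop) fun t => by positivity)

theorem memLp_weight : MemLp weight 2 (volume : Measure ℝ) := by
  rw [memLp_two_iff_integrable_sq_norm continuous_weight.aestronglyMeasurable]
  refine integrable_inv_one_add_sq.mono'
    (continuous_weight.norm.pow 2).aestronglyMeasurable (Filter.Eventually.of_forall fun t => ?_)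
  have h0 : 0 ≤ (1 + t ^ 2)⁻¹ := by positivity
  have h1 : (1 + t ^ 2)⁻¹ ≤ 1 := inv_le_one_of_one_le₀ (by nlinarith)
  simp only [weight, Complex.norm_real, Real.norm_eq_abs, abs_pow, abs_of_nonneg h0]
  nlinarith

theorem memLp_weight_smul (c : H) : MemLp (fun t => weight t • c) 2 (volume : Measure ℝ) := by
  refine MemLp.of_le_mul (c := ‖c‖) memLp_weight
    (continuous_weight.smul continuous_const).aestronglyMeasurable
    (Filter.Eventually.of_forall fun t => ?_)
  rw [norm_smul, mul_comm]

/-- The vector `weight(t) • c` in `L₂(ℝ; H)`. -/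
def weightVec (c : H) : L2R H := (memLp_weight_smul c).toLp _

theorem weightVec_coeFn (c : H) : weightVec c =ᵐ[volume] fun t => weight t • c :=
  (memLp_weight_smul c).coeFn_toLp

/-- For `W` commuting with scalar multiplications, `symbol W c t` is the fibre operator `W(t)`
applied to `c`. -/
def symbol (W : L2R H →L[ℂ] L2R H) (c : H) (t : ℝ) : H := (weight t)⁻¹ • W (weightVec c) t

theorem weight_smul_symbol (W : L2R H →L[ℂ] L2R H) (c : H) (t : ℝ) :
    weight t • symbol W c t = W (weightVec c) t :=
  smul_inv_smul₀ (weight_ne_zero t) _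

theorem eq_of_inner_basis {ι : Type*} (b : HilbertBasis ι ℂ H) {x y : H}
    (h : ∀ i, inner ℂ (b i) x = inner ℂ (b i) y) : x = y := by
  refine b.repr.injective ?_
  ext i
  rw [b.repr_apply_apply, b.repr_apply_apply, h]

theorem clm_eq_of_basis {ι : Type*} (b : HilbertBasis ι ℂ H) {E : Type*} [NormedAddCommGroup E]
    [NormedSpace ℂ E] {A B : H →L[ℂ] E} (h : ∀ i, A (b i) = B (b i)) : A = B := by
  refine ContinuousLinearMap.ext_on (s := Set.range b) ?_ ?_
  · exact Submodule.dense_iff_topologicalClosure_eq_top.2 b.dense_span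
  · rintro _ ⟨i, rfl⟩
    exact h i

theorem exists_linearIsometry_of_orthonormal [CompleteSpace H] {ι : Type*}
    (b : HilbertBasis ι ℂ H) {v : ι → H} (hv : Orthonormal ℂ v) :
    ∃ A : H →ₗᵢ[ℂ] H, ∀ i, A (b i) = v i := by
  classical
  refine ⟨hv.orthogonalFamily.linearIsometry.comp b.repr.toLinearIsometry, fun i => ?_⟩
  change hv.orthogonalFamily.linearIsometry (b.repr (b i)) = v i
  rw [b.repr_self]
  exact (hv.orthogonalFamily.linearIsometry_apply_single (1 : ℂ)).trans (one_smul ℂ (v i))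

/-- `v` and `w` are the images of the basis `b` under a unitary operator and its adjoint. -/
structure IsAdjointPair {ι : Type*} (b : HilbertBasis ι ℂ H) (v w : ι → H) : Prop where
  left : ∀ i j, inner ℂ (v i) (v j) = inner ℂ (b i) (b j)
  right : ∀ i j, inner ℂ (w i) (w j) = inner ℂ (b i) (b j)
  adj : ∀ i j, inner ℂ (w i) (b j) = inner ℂ (b i) (v j)

theorem orthonormal_of_inner_eq_basis {ι : Type*} (b : HilbertBasis ι ℂ H) {v : ι → H}
    (h : ∀ i j, inner ℂ (v i) (v j) = inner ℂ (b i) (b j)) : Orthonormal ℂ v := by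
  classical
  rw [orthonormal_iff_ite]
  intro i j
  rw [h, orthonormal_iff_ite.1 b.orthonormal]

/-- The orthonormal family v only yields an isometry A, possibly not onto. The relation `adj`
identifies A^* with the isometry B defined by w, and B^*B = 1 reads AA^* = 1. -/
theorem IsAdjointPair.exists_unitary [CompleteSpace H] {ι : Type*} {b : HilbertBasis ι ℂ H}
    {v w : ι → H} (h : IsAdjointPair b v w) :
    ∃ U : unitary (H →L[ℂ] H), ∀ i, (U : H →L[ℂ] H) (b i) = v i := by
  obtain ⟨A, hA⟩ :=
    exists_linearIsometry_of_orthonormal b (orthonormal_of_inner_eq_basis b h.left)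
  obtain ⟨B, hB⟩ :=
    exists_linearIsometry_of_orthonormal b (orthonormal_of_inner_eq_basis b h.right)
  have hAB : A.toContinuousLinearMap.adjoint = B.toContinuousLinearMap := by
    refine clm_eq_of_basis b fun k => ?_
    refine ext_inner_right ℂ fun x => ?_
    rw [ContinuousLinearMap.adjoint_inner_left]
    suffices hx : (innerSL ℂ (b k)).comp A.toContinuousLinearMap
        = innerSL ℂ (B.toContinuousLinearMap (b k)) from congr($hx x)
    refine clm_eq_of_basis b fun i => ?_
    simp only [ContinuousLinearMap.comp_apply, innerSL_apply_apply,
      LinearIsometry.coe_toContinuousLinearMap, hA, hB, h.adj]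
  have h1 : A.toContinuousLinearMap.adjoint * A.toContinuousLinearMap = 1 :=
    (ContinuousLinearMap.norm_map_iff_adjoint_comp_self _).1 A.norm_map
  have h2 : B.toContinuousLinearMap.adjoint * B.toContinuousLinearMap = 1 :=
    (ContinuousLinearMap.norm_map_iff_adjoint_comp_self _).1 B.norm_map
  rw [← hAB, ContinuousLinearMap.adjoint_adjoint] at h2
  exact ⟨⟨A.toContinuousLinearMap, h1, h2⟩, hA⟩

section Symbol

variable [CompleteSpace H]

/-- Constant functions are not in L₂(ℝ; H), so the adjoint relation is tested on weight · c and the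
nonzero real weight is cancelled. -/
theorem ae_inner_symbol_adjoint {W : L2R H →L[ℂ] L2R H} (hW : ∀ φ, Commute W (scalarMul φ))
    (c : H) (f : L2R H) :
    ∀ᵐ t, inner ℂ (symbol W.adjoint c t) (f t) = inner ℂ c (W f t) := by
  filter_upwards [ae_inner_adjoint_apply hW (weightVec c) f, weightVec_coeFn c] with t h1 h2
  rw [← weight_smul_symbol, h2, inner_smul_left, inner_smul_left, conj_weight] at h1
  exact mul_left_cancel₀ (weight_ne_zero t) h1

theorem ae_inner_symbol_adjoint_const {W : L2R H →L[ℂ] L2R H}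
    (hW : ∀ φ, Commute W (scalarMul φ)) (c d : H) :
    ∀ᵐ t, inner ℂ (symbol W.adjoint c t) d = inner ℂ c (symbol W d t) := by
  filter_upwards [ae_inner_symbol_adjoint hW c (weightVec d), weightVec_coeFn d] with t h1 h2
  rw [← weight_smul_symbol, h2, inner_smul_right, inner_smul_right] at h1
  exact mul_left_cancel₀ (weight_ne_zero t) h1

/-- This is the adjoint relation for W^* applied to W(weight · d), where W^*W = 1. -/
theorem ae_inner_symbol_symbol {W : L2R H →L[ℂ] L2R H} (hW : ∀ φ, Commute W (scalarMul φ))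
    (hu : W ∈ unitary (L2R H →L[ℂ] L2R H)) (c d : H) :
    ∀ᵐ t, inner ℂ (symbol W c t) (symbol W d t) = inner ℂ c d := by
  have h := ae_inner_symbol_adjoint (fun φ => commute_adjoint_of_mem_unitary hu (hW φ)) c
    (W (weightVec d))
  have hid : W.adjoint (W (weightVec d)) = weightVec d :=
    congr($(Unitary.star_mul_self_of_mem hu) (weightVec d))
  rw [ContinuousLinearMap.adjoint_adjoint, hid] at h
  filter_upwards [h, weightVec_coeFn d] with t h1 h2
  rw [← weight_smul_symbol, h2, inner_smul_right, inner_smul_right] at h1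
  exact mul_left_cancel₀ (weight_ne_zero t) h1

theorem ae_isAdjointPair_symbol {ι : Type*} [Countable ι] (b : HilbertBasis ι ℂ H)
    {W : L2R H →L[ℂ] L2R H} (hW : ∀ φ, Commute W (scalarMul φ))
    (hu : W ∈ unitary (L2R H →L[ℂ] L2R H)) :
    ∀ᵐ t, IsAdjointPair b (fun i => symbol W (b i) t) fun i => symbol W.adjoint (b i) t := by
  have h1 := ae_all_iff.2 fun i => ae_all_iff.2 fun j => ae_inner_symbol_symbol hW hu (b i) (b j)
  have h2 := ae_all_iff.2 fun i => ae_all_iff.2 fun j => ae_inner_symbol_symbol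
    (fun φ => commute_adjoint_of_mem_unitary hu (hW φ)) (Unitary.star_mem hu) (b i) (b j)
  have h3 := ae_all_iff.2 fun i => ae_all_iff.2 fun j =>
    ae_inner_symbol_adjoint_const hW (b i) (b j)
  filter_upwards [h1, h2, h3] with t h1 h2 h3
  exact ⟨h1, h2, h3⟩

/-- Makes the symbol independent of the weight; the cocycle identity needs this because translation
shifts the weight. -/
theorem ae_apply_eq_smul_symbol {ι : Type*} [Countable ι] (b : HilbertBasis ι ℂ H)
    {W : L2R H →L[ℂ] L2R H} (hW : ∀ φ, Commute W (scalarMul φ)) {f : L2R H} {h : ℝ → ℂ} {c : H}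
    (hf : f =ᵐ[volume] fun t => h t • c) : ∀ᵐ t, W f t = h t • symbol W c t := by
  have h1 := ae_all_iff.2 fun i => ae_inner_symbol_adjoint hW (b i) f
  have h2 := ae_all_iff.2 fun i => ae_inner_symbol_adjoint_const hW (b i) c
  filter_upwards [h1, h2, hf] with t h1 h2 h3
  refine eq_of_inner_basis b fun i => ?_
  rw [← h1, h3, inner_smul_right, inner_smul_right, h2]

/-- The cocycle identity, at the level of symbols. -/
theorem ae_inner_symbol_cocycle {ι : Type*} [Countable ι] (b : HilbertBasis ι ℂ H)
    {W₁ W₂ : L2R H →L[ℂ] L2R H} (hW₁ : ∀ φ, Commute W₁ (scalarMul φ))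
    (hW₂ : ∀ φ, Commute W₂ (scalarMul φ)) (σ : ℝ) (c d : H) :
    ∀ᵐ t, inner ℂ (symbol W₁.adjoint c t) (symbol W₂ d (t - σ))
      = inner ℂ c (symbol (W₁ * timeShift σ * W₂ * timeShift (-σ)) d t) := by
  have hd : timeShift (-σ) (weightVec d) =ᵐ[volume] fun t => weight (t + σ) • d := by
    filter_upwards [timeShift_coeFn (-σ) (weightVec d),
      ae_comp_sub_right (weightVec_coeFn d) (-σ)] with t h1 h2
    rw [h1, h2, sub_neg_eq_add]
  filter_upwards [ae_inner_symbol_adjoint hW₁ c (timeShift σ (W₂ (timeShift (-σ) (weightVec d)))),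
    timeShift_coeFn σ (W₂ (timeShift (-σ) (weightVec d))),
    ae_comp_sub_right (ae_apply_eq_smul_symbol b hW₂ hd) σ] with t h1 h2 h3
  refine mul_left_cancel₀ (weight_ne_zero t) ?_
  rw [← inner_smul_right, ← inner_smul_right, weight_smul_symbol]
  rw [h2, h3, sub_add_cancel] at h1
  exact h1

end Symbol

/-! ### Fubini arguments and measurable choice of unitaries -/

/-- Fubini along the lines `τ = t - a - s`. -/
theorem ae_ae_sub_of_ae {p : ℝ → ℝ → Prop} (hp : MeasurableSet {x : ℝ × ℝ | p x.1 x.2})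
    (h : ∀ τ, ∀ᵐ t, p τ t) (a : ℝ) : ∀ᵐ s, ∀ᵐ t, p (t - a - s) t := by
  have h1 : ∀ᵐ t, ∀ᵐ τ, p τ t := (Measure.ae_ae_comm hp).1 (Filter.Eventually.of_forall h)
  have hm : MeasurableSet {x : ℝ × ℝ | p (x.2 - a - x.1) x.2} :=
    hp.preimage (f := fun x : ℝ × ℝ => (x.2 - a - x.1, x.2)) (by fun_prop)
  rw [Measure.ae_ae_comm hm]
  filter_upwards [h1] with t ht
  -- For fixed t, s ↦ t - a - s preserves Lebesgue measure.
  exact ae_comp_sub_left ht (t - a)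

/-- Needed to pick one s that works for almost every σ: Fubini makes the exceptional set of s
independent of σ. -/
theorem ae_ae_ae_rotate {p : ℝ → ℝ → ℝ → Prop}
    (hp : MeasurableSet {x : ℝ × ℝ × ℝ | p x.1 x.2.1 x.2.2})
    (h : ∀ σ, ∀ᵐ s, ∀ᵐ t, p σ s t) : ∀ᵐ s, ∀ᵐ σ, ∀ᵐ t, p σ s t := by
  have h1 : ∀ σ, ∀ᵐ q : ℝ × ℝ, p σ q.1 q.2 := by
    intro σ
    have hm : MeasurableSet {q : ℝ × ℝ | p σ q.1 q.2} :=
      hp.preimage (f := fun q : ℝ × ℝ => (σ, q.1, q.2)) (by fun_prop)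
    exact (Measure.ae_prod_mem_iff_ae_ae_mem hm).2 (h σ)
  have h2 : ∀ᵐ q : ℝ × ℝ, ∀ᵐ σ, p σ q.1 q.2 :=
    (Measure.ae_ae_comm (μ := volume) (ν := (volume : Measure (ℝ × ℝ)))
      (p := fun σ q => p σ q.1 q.2) hp).1 (Filter.Eventually.of_forall h1)
  filter_upwards [Measure.ae_ae_of_ae_prod h2] with s hs
  have hm : MeasurableSet {x : ℝ × ℝ | p x.2 s x.1} :=
    hp.preimage (f := fun x : ℝ × ℝ => (x.2, s, x.1)) (by fun_prop)
  exact (Measure.ae_ae_comm hm).1 hs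

theorem measurableSet_isAdjointPair {ι : Type*} [Countable ι] (b : HilbertBasis ι ℂ H)
    {X : Type*} [MeasurableSpace X] {v w : ι → X → H} (hv : ∀ i, StronglyMeasurable (v i))
    (hw : ∀ i, StronglyMeasurable (w i)) :
    MeasurableSet {x | IsAdjointPair b (fun i => v i x) fun i => w i x} := by
  have hset : {x | IsAdjointPair b (fun i => v i x) fun i => w i x}
      = (⋂ i, ⋂ j, {x | inner ℂ (v i x) (v j x) = inner ℂ (b i) (b j)}) ∩
        ((⋂ i, ⋂ j, {x | inner ℂ (w i x) (w j x) = inner ℂ (b i) (b j)}) ∩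
          ⋂ i, ⋂ j, {x | inner ℂ (w i x) (b j) = inner ℂ (b i) (v j x)}) := by
    ext x
    simp only [Set.mem_inter_iff, Set.mem_iInter, Set.mem_ofPred_eq]
    exact ⟨fun h => ⟨h.left, h.right, h.adj⟩, fun h => ⟨h.1, h.2.1, h.2.2⟩⟩
  rw [hset]
  refine (MeasurableSet.iInter fun i => MeasurableSet.iInter fun j => ?_).inter
    ((MeasurableSet.iInter fun i => MeasurableSet.iInter fun j => ?_).inter
      (MeasurableSet.iInter fun i => MeasurableSet.iInter fun j => ?_))
  · exact measurableSet_eq_fun ((hv i).inner (hv j)).measurable measurable_const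
  · exact measurableSet_eq_fun ((hw i).inner (hw j)).measurable measurable_const
  · exact measurableSet_eq_fun ((hw i).inner stronglyMeasurable_const).measurable
      (stronglyMeasurable_const.inner (hv j)).measurable

/-- An almost everywhere defined measurable field of adjoint pairs comes from a measurable
unitary-valued function. -/
theorem exists_measurable_unitary [CompleteSpace H] {ι : Type*} [Countable ι]
    (b : HilbertBasis ι ℂ H) {v w : ι → ℝ → H} (hv : ∀ i, StronglyMeasurable (v i))
    (hw : ∀ i, StronglyMeasurable (w i))
    (h : ∀ᵐ t, IsAdjointPair b (fun i => v i t) fun i => w i t) :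
    ∃ U : ℝ → unitary (H →L[ℂ] H), (MeasurableOpFun fun t => (U t : H →L[ℂ] H)) ∧
      ∀ᵐ t, ∀ i, (U t : H →L[ℂ] H) (b i) = v i t := by
  classical
  have hS := measurableSet_isAdjointPair b hv hw
  set S := {t | IsAdjointPair b (fun i => v i t) fun i => w i t}
  have hex : ∀ t, ∃ U : unitary (H →L[ℂ] H),
      ∀ i, (U : H →L[ℂ] H) (b i) = S.piecewise (v i) (fun _ => b i) t := by
    intro t
    by_cases ht : t ∈ S
    · obtain ⟨U, hU⟩ := IsAdjointPair.exists_unitary ht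
      exact ⟨U, fun i => by rw [hU, Set.piecewise_eq_of_mem _ _ _ ht]⟩
    -- On the measurable null set where the pair relations fail, the identity keeps U unitary
    -- everywhere and measurable.
    · exact ⟨1, fun i => by rw [Set.piecewise_eq_of_notMem _ _ _ ht]; rfl⟩
  choose U hU using hex
  refine ⟨U, measurableOpFun_of_basis b fun i => ?_, ?_⟩
  · simp only [hU]
    exact (hv i).piecewise hS stronglyMeasurable_const
  · filter_upwards [h] with t ht i
    have htS : t ∈ S := ht
    rw [hU, Set.piecewise_eq_of_mem _ _ _ htS]

/-- The symbols of a strongly continuous family have jointly measurable versions. -/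
theorem exists_stronglyMeasurable_symbol [CompleteSpace H] [TopologicalSpace.SeparableSpace H]
    {W : ℝ → L2R H →L[ℂ] L2R H} (hW : ∀ f, Continuous fun σ => W σ f) (c : H) :
    ∃ F : ℝ × ℝ → H, StronglyMeasurable F ∧
      ∀ σ, ∀ᵐ t, F (σ, t) = symbol (W σ) c t := by
  obtain ⟨F, hF, h⟩ := exists_stronglyMeasurable_uncurry (hW (weightVec c))
  refine ⟨fun p => (weight p.2)⁻¹ • F p, ?_, fun σ => ?_⟩
  · exact ((continuous_weight.inv₀ weight_ne_zero).comp continuous_snd).stronglyMeasurable.smul hF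
  · filter_upwards [h σ] with t ht
    rw [ht, symbol]

/-- Two one-parameter semigroups of elements which agree almost everywhere agree everywhere. -/
theorem eq_of_ae_eq_of_map_add {M : Type*} [Mul M] {f g : ℝ → M}
    (hf : ∀ σ τ, f (σ + τ) = f σ * f τ) (hg : ∀ σ τ, g (σ + τ) = g σ * g τ)
    (h : ∀ᵐ σ, f σ = g σ) (σ : ℝ) : f σ = g σ := by
  -- Split σ = (σ - a) + a with both summands outside the null set.
  obtain ⟨a, h1, h2⟩ := (h.and (ae_comp_sub_left h σ)).exists
  rw [← sub_add_cancel σ a, hf, hg, h1, h2]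

/-! ### The two directions of the theorem -/

section Group

variable [CompleteSpace H] {V : ℝ → L2R H →L[ℂ] L2R H}

theorem timeShift_mem_unitary (σ : ℝ) :
    (timeShift σ : L2R H →L[ℂ] L2R H) ∈ unitary (L2R H →L[ℂ] L2R H) := by
  have h : star (timeShift σ : L2R H →L[ℂ] L2R H) = timeShift (-σ) := adjoint_timeShift σ
  rw [Unitary.mem_iff, h]
  refine ⟨?_, timeShift_mul_neg σ⟩
  simpa using timeShift_mul_neg (H := H) (-σ)

theorem IsUnitaryGroup.adjoint_eq (hV : IsUnitaryGroup V) (σ : ℝ) :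
    (V σ).adjoint = V (-σ) := by
  refine left_inv_eq_right_inv (Unitary.star_mul_self_of_mem (hV.mem_unitary σ)) ?_
  rw [← hV.map_add, add_neg_cancel, hV.map_zero]

/-- The forward direction: a strongly continuous unitary evolution group is implemented by a
measurable unitary-valued function. -/
theorem IsUnitaryEvolutionGroup.exists_unitary [TopologicalSpace.SeparableSpace H]
    (hV : IsUnitaryEvolutionGroup V) (hcont : ∀ f : L2R H, Continuous fun σ => V σ f) :
    ∃ (U : ℝ → unitary (H →L[ℂ] H)) (hU : MeasurableOpFun fun t => (U t : H →L[ℂ] H)),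
      ∀ σ, V σ * mulOp (fun t => (U t : H →L[ℂ] H)) hU (essBoundedOpFun_unitary U)
        = mulOp (fun t => (U t : H →L[ℂ] H)) hU (essBoundedOpFun_unitary U) * timeShift σ := by
  obtain ⟨ι, b, -⟩ := exists_hilbertBasis ℂ H
  have := countable_index_of_hilbertBasis b
  have hG := hV.isUnitaryGroup
  let W : ℝ → L2R H →L[ℂ] L2R H := fun σ => V σ * timeShift (-σ)
  have hWc : ∀ σ φ, Commute (W σ) (scalarMul φ) := by
    intro σ φ
    have h := hV.commute σ φ
    rwa [adjoint_timeShift] at h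
  have hWu : ∀ σ, W σ ∈ unitary (L2R H →L[ℂ] L2R H) := fun σ =>
    mul_mem (hG.mem_unitary σ) (timeShift_mem_unitary _)
  have hWadj : ∀ σ, (W σ).adjoint = timeShift σ * V (-σ) := by
    intro σ
    have h : (W σ).adjoint = (timeShift (-σ)).adjoint * (V σ).adjoint := star_mul _ _
    rw [h, adjoint_timeShift, neg_neg, hG.adjoint_eq]
  have hWadd : ∀ σ τ, W (σ + τ) = W σ * timeShift σ * W τ * timeShift (-σ) := by
    intro σ τ
    have h : (timeShift (-σ) : L2R H →L[ℂ] L2R H) * timeShift σ = 1 := by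
      simpa using timeShift_mul_neg (H := H) (-σ)
    have h' : (timeShift (-τ) : L2R H →L[ℂ] L2R H) * timeShift (-σ) = timeShift (-(σ + τ)) := by
      rw [← timeShift_add]
      congr 1
      ring
    calc W (σ + τ) = V σ * 1 * V τ * (timeShift (-τ) * timeShift (-σ)) := by
          rw [h', mul_one, ← hG.map_add]
      _ = _ := by rw [← h]; simp only [W, mul_assoc]
  have hWcont : ∀ f, Continuous fun σ => W σ f := by
    intro f
    have h1 : Continuous fun σ => timeShift (-σ) f :=
      (continuous_timeShift (continuous_const (y := f))).comp continuous_neg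
    rw [continuous_iff_continuousAt]
    intro σ₀
    have h2 : Filter.Tendsto
        (fun σ => V σ (timeShift (-σ) f - timeShift (-σ₀) f)) (nhds σ₀) (nhds 0) := by
      have h3 : Filter.Tendsto (fun σ => timeShift (-σ) f - timeShift (-σ₀) f) (nhds σ₀)
          (nhds 0) := by
        have h5 : Continuous fun σ => timeShift (-σ) f - timeShift (-σ₀) f :=
          h1.sub continuous_const
        simpa only [sub_self] using h5.tendsto σ₀
      -- V(σ) is isometric, so the moving operator does not affect the norm.
      rw [tendsto_zero_iff_norm_tendsto_zero] at h3 ⊢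
      refine h3.congr fun σ => ?_
      exact (ContinuousLinearMap.norm_map_of_mem_unitary (hG.mem_unitary σ) _).symm
    have h4 := h2.add ((hcont (timeShift (-σ₀) f)).tendsto σ₀)
    rw [zero_add] at h4
    refine h4.congr fun σ => ?_
    rw [map_sub, sub_add_cancel]
    rfl
  have hWacont : ∀ f, Continuous fun σ => (W σ).adjoint f := by
    intro f
    simp only [hWadj]
    exact continuous_timeShift ((hcont f).comp continuous_neg)
  choose F hFm hF using fun i => exists_stronglyMeasurable_symbol hWcont (b i)
  choose G hGm hGs using fun i => exists_stronglyMeasurable_symbol hWacont (b i)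
  have hpair : ∀ σ, ∀ᵐ t, IsAdjointPair b (fun i => F i (σ, t)) fun i => G i (σ, t) := by
    intro σ
    filter_upwards [ae_isAdjointPair_symbol b (hWc σ) (hWu σ), ae_all_iff.2 fun i => hF i σ,
      ae_all_iff.2 fun i => hGs i σ] with t h1 h2 h3
    simpa only [h2, h3] using h1
  -- Matrix entries of W(σ,t) W(τ,t-σ) = W(σ+τ,t), with W(σ,t) moved to the left slot as its
  -- adjoint.
  have hcoc : ∀ σ τ, ∀ᵐ t, ∀ k i,
      inner ℂ (G k (σ, t)) (F i (τ, t - σ)) = inner ℂ (b k) (F i (σ + τ, t)) := by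
    intro σ τ
    have h := ae_all_iff.2 fun k => ae_all_iff.2 fun i =>
      ae_inner_symbol_cocycle b (hWc σ) (hWc τ) σ (b k) (b i)
    filter_upwards [h, ae_all_iff.2 fun i => hF i (σ + τ), ae_all_iff.2 fun i => hGs i σ,
      ae_comp_sub_right (ae_all_iff.2 fun i => hF i τ) σ] with t h1 h2 h3 h4 k i
    rw [h2, h3, h4, h1, hWadd]
  have hs₁ : ∀ᵐ s, ∀ᵐ t, IsAdjointPair b (fun i => F i (t - s, t)) fun i => G i (t - s, t) := by
    simpa only [sub_zero] using
      ae_ae_sub_of_ae (measurableSet_isAdjointPair b hFm hGm) hpair 0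
  have hcm : ∀ {X : Type} [MeasurableSpace X] {f₁ f₂ f₃ f₄ f₅ f₆ : X → ℝ}, Measurable f₁ →
      Measurable f₂ → Measurable f₃ → Measurable f₄ → Measurable f₅ → Measurable f₆ →
      MeasurableSet {x | ∀ k i, inner ℂ (G k (f₁ x, f₂ x)) (F i (f₃ x, f₄ x))
        = inner ℂ (b k) (F i (f₅ x, f₆ x))} := by
    intro X _ f₁ f₂ f₃ f₄ f₅ f₆ h₁ h₂ h₃ h₄ h₅ h₆
    simp only [Set.ofPred_forall]
    refine MeasurableSet.iInter fun k => MeasurableSet.iInter fun i => ?_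
    exact measurableSet_eq_fun
      (((hGm k).comp_measurable (h₁.prodMk h₂)).inner
        ((hFm i).comp_measurable (h₃.prodMk h₄))).measurable
      (stronglyMeasurable_const.inner ((hFm i).comp_measurable (h₅.prodMk h₆))).measurable
  have hs₂ : ∀ᵐ s, ∀ᵐ σ, ∀ᵐ t, ∀ k i,
      inner ℂ (G k (σ, t)) (F i (t - σ - s, t - σ)) = inner ℂ (b k) (F i (t - s, t)) := by
    refine ae_ae_ae_rotate (p := fun σ s t => ∀ k i, inner ℂ (G k (σ, t))
      (F i (t - σ - s, t - σ)) = inner ℂ (b k) (F i (t - s, t))) ?_ fun σ => ?_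
    · exact hcm (by fun_prop) (by fun_prop) (by fun_prop) (by fun_prop) (by fun_prop)
        (by fun_prop)
    · have h := ae_ae_sub_of_ae (p := fun τ t => ∀ k i,
        inner ℂ (G k (σ, t)) (F i (τ, t - σ)) = inner ℂ (b k) (F i (σ + τ, t)))
        (hcm (by fun_prop) (by fun_prop) (by fun_prop) (by fun_prop) (by fun_prop)
          (by fun_prop)) (hcoc σ) σ
      filter_upwards [h] with s hs
      filter_upwards [hs] with t ht k i
      rw [ht, show σ + (t - σ - s) = t - s by ring]
  -- This generic s defines U(t) = W(t-s,t).
  obtain ⟨s, hs₁, hs₂⟩ := (hs₁.and hs₂).exists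
  obtain ⟨U, hU, hUF⟩ := exists_measurable_unitary b
    (v := fun i t => F i (t - s, t)) (w := fun i t => G i (t - s, t))
    (fun i => (hFm i).comp_measurable (by fun_prop))
    (fun i => (hGm i).comp_measurable (by fun_prop)) hs₁
  refine ⟨U, hU, ?_⟩
  set M := mulOp (fun t => (U t : H →L[ℂ] H)) hU (essBoundedOpFun_unitary U) with hM
  have hMu : M ∈ unitary (L2R H →L[ℂ] L2R H) := mulOp_unitary_mem_unitary U hU
  have hae : ∀ᵐ σ, V σ * M = M * timeShift σ := by
    filter_upwards [hs₂] with σ hσ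
    refine ContinuousLinearMap.ext fun f => Lp.ext ?_
    have hVW : V σ (M f) = W σ (timeShift σ (M f)) := by
      have h : V σ = W σ * timeShift σ := by
        have h' : (timeShift (-σ) : L2R H →L[ℂ] L2R H) * timeShift σ = 1 := by
          simpa using timeShift_mul_neg (H := H) (-σ)
        rw [mul_assoc, h', mul_one]
      exact congr($h (M f))
    filter_upwards [hσ, hUF, ae_comp_sub_right hUF σ,
      ae_all_iff.2 fun k => ae_inner_symbol_adjoint (hWc σ) (b k) (timeShift σ (M f)),
      ae_all_iff.2 fun k => hGs k σ, timeShift_coeFn σ (M f),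
      ae_comp_sub_right (mulOp_coeFn hU (essBoundedOpFun_unitary U) f) σ,
      mulOp_coeFn hU (essBoundedOpFun_unitary U) (timeShift σ f), timeShift_coeFn σ f]
      with t h1 h2 h3 h4 h5 h6 h7 h8 h9
    rw [mul_apply_eq_comp, mul_apply_eq_comp, hVW]
    refine eq_of_inner_basis b fun k => ?_
    rw [← h4, ← h5, h6, hM, h7, h8, h9]
    -- The claim W(σ,t) U(t-σ) = U(t) is now an equality of functionals, checkable on the basis.
    suffices hx : (innerSL ℂ (G k (σ, t))).comp (U (t - σ) : H →L[ℂ] H)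
        = (innerSL ℂ (b k)).comp (U t : H →L[ℂ] H) from congr($hx (f (t - σ)))
    refine clm_eq_of_basis b fun i => ?_
    simp only [ContinuousLinearMap.comp_apply, innerSL_apply_apply, h2, h3, h1]
  have hinv : M.adjoint * M = 1 := Unitary.star_mul_self_of_mem hMu
  have hinv' : M * M.adjoint = 1 := Unitary.mul_star_self_of_mem hMu
  have key : ∀ σ, V σ = M * timeShift σ * M.adjoint := by
    refine eq_of_ae_eq_of_map_add hG.map_add (fun σ τ => ?_) ?_
    · calc M * timeShift (σ + τ) * M.adjoint
          = M * timeShift σ * 1 * timeShift τ * M.adjoint := by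
            rw [timeShift_add, mul_one]; simp only [mul_assoc]
        _ = _ := by rw [← hinv]; simp only [mul_assoc]
    · filter_upwards [hae] with σ hσ
      rw [← hσ, mul_assoc, hinv', mul_one]
  intro σ
  rw [key σ, mul_assoc, hinv, mul_one]

/-- The backward direction. -/
theorem isUnitaryEvolutionGroup_of_eq [TopologicalSpace.SeparableSpace H] (hV : IsUnitaryGroup V)
    (U : ℝ → unitary (H →L[ℂ] H)) (hU : MeasurableOpFun fun t => (U t : H →L[ℂ] H))
    (h : ∀ σ, V σ = mulOp (fun t => (U t : H →L[ℂ] H)) hU (essBoundedOpFun_unitary U)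
      * timeShift σ
      * (mulOp (fun t => (U t : H →L[ℂ] H)) hU (essBoundedOpFun_unitary U)).adjoint) :
    IsUnitaryEvolutionGroup V := by
  refine ⟨hV, fun σ φ => ?_⟩
  have hc := commute_mulOp_scalarMul hU (essBoundedOpFun_unitary U)
  have hMu := mulOp_unitary_mem_unitary U hU
  rw [h σ]
  set M := mulOp (fun t => (U t : H →L[ℂ] H)) hU (essBoundedOpFun_unitary U)
  -- T_{-σ} turns φ into a translate, M^* commutes with that, and T_σ restores φ.
  have hshift : Commute (timeShift σ * M.adjoint * timeShift (-σ)) (scalarMul φ) :=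
    calc timeShift σ * M.adjoint * timeShift (-σ) * scalarMul φ
        = timeShift σ * (M.adjoint * scalarMul (translate (-σ) φ)) * timeShift (-σ) := by
          rw [mul_assoc, timeShift_mul_scalarMul]; simp only [mul_assoc]
      _ = timeShift σ * scalarMul (translate (-σ) φ) * M.adjoint * timeShift (-σ) := by
          rw [(commute_adjoint_of_mem_unitary hMu (hc _)).eq]; simp only [mul_assoc]
      _ = scalarMul φ * (timeShift σ * M.adjoint * timeShift (-σ)) := by
          rw [timeShift_mul_scalarMul, translate_translate_neg]; simp only [mul_assoc]
  rw [adjoint_timeShift]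
  simpa only [mul_assoc] using (hc φ).mul_left hshift

end Group

end Howland

end

theorem theorem1 {H : Type*} [NormedAddCommGroup H] [InnerProductSpace ℂ H] [CompleteSpace H]
    [TopologicalSpace.SeparableSpace H]
    (V : ℝ → Howland.L2R H →L[ℂ] Howland.L2R H)
    (hV : Howland.IsUnitaryGroup V) (hcont : ∀ f : Howland.L2R H, Continuous fun σ => V σ f) :
    Howland.IsUnitaryEvolutionGroup V ↔
      ∃ (U : ℝ → unitary (H →L[ℂ] H))
        (hU : Howland.MeasurableOpFun fun t => (U t : H →L[ℂ] H)),
        ∀ σ : ℝ,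
          V σ = Howland.mulOp (fun t => (U t : H →L[ℂ] H)) hU (Howland.essBoundedOpFun_unitary U)
            * Howland.timeShift σ
            * (Howland.mulOp (fun t => (U t : H →L[ℂ] H)) hU
                (Howland.essBoundedOpFun_unitary U)).adjoint := by
  constructor
  · intro h
    obtain ⟨U, hU, hUV⟩ := h.exists_unitary hcont
    refine ⟨U, hU, fun σ => ?_⟩
    rw [← hUV, mul_assoc]
    exact ((congrArg (V σ * ·) (Unitary.mul_star_self_of_mem
      (Howland.mulOp_unitary_mem_unitary U hU))).trans (mul_one _)).symm
  · rintro ⟨U, hU, h⟩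
    exact Howland.isUnitaryEvolutionGroup_of_eq hV U hU h
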